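/- Let $X$ be a topological space with basepoint $x_0$. For $n\ge 1$ let $\tau_n(X,x_0)=\pi_1\bigl(X^{T^{n-1}},\overline{x_0}\bigr)$ be the $n$-th Fox torus homotopy group, where $T^{n-1}$ is the $(n-1)$-dimensional torus ($T^0$ is a point), $X^{T^{n-1}}$ is the space of all unbased continuous maps $T^{n-1}\to X$ with the compact-open topology, and $\overline{x_0}$ is the constant map at $x_0$. Let $\pi_n(X,x_0)\to\tau_n(X,x_0)$ be the canonical homomorphism $$\pi_n(X,x_0)\cong\pi_1(\Omega^{n-1}X,\overline{x_0})\longrightarrow\pi_1\bigl(X^{T^{n-1}},\overline{x_0}\bigr)=\tau_n(X,x_0)$$ induced by composing maps $(I^{n-1},\partial I^{n-1})\to (X,x_0)$ with the pinch map $T^{n-1}\to I^{n-1}/\partial I^{n-1}$. Then: (1) For every $n$, one has $\tau_k(X,x_0)=1$ for all $1\le k\le n$ if and only if $\pi_k(X,x_0)=1$ for all $1\le k\le n$. (2) For every $n\ge 1$, the canonical homomorphism $\pi_n(X,x_0)\to\tau_n(X,x_0)$ is an isomorphism if and only if $\pi_k(X,x_0)=1$ for all $1\le k\le n-1$. In particular,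 if $X$ is path-connected, it is an isomorphism if and only if $X$ is $(n-1)$-connected (that is, path-connected with $\pi_k(X,x)=1$ for all $1\le k\le n-1$ and all $x \in X$). -/

import Mathlib

open scoped unitInterval Topology Topology.Homotopy

noncomputable section

namespace Fox

/-- The torus `T^N`, a product of circles `ℝ / ℤ` indexed by `N`.
The `m`-torus is `Torus (Fin m)`; `Torus (Fin 0)` is a point. -/
abbrev Torus (N : Type) : Type := N → UnitAddCircle

/-- The `n`-th torus homotopy group `τ_n(X, x₀) = π₁(X^{T^{n-1}}, const x₀)`, for `n ≥ 1`.
Here `C(Torus (Fin (n - 1)), X)` is the space of all (unbased) continuous maps `T^{n-1} → X` with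
the compact-open topology. (The value at `n = 0` is meaningless and never used.) -/
abbrev TorusHomotopyGroup (n : ℕ) (X : Type*) [TopologicalSpace X] (x₀ : X) : Type _ :=
  FundamentalGroup C(Torus (Fin (n - 1)), X) (ContinuousMap.const _ x₀)

/-- A space is `m`-connected if it is (nonempty and) path-connected and its homotopy groups `π_k`
vanish for `1 ≤ k ≤ m`, at every base point. -/
def IsNConnected (m : ℕ) (X : Type*) [TopologicalSpace X] : Prop :=
  PathConnectedSpace X ∧ ∀ (x : X) (k : ℕ), 1 ≤ k → k ≤ m → Subsingleton (π_ k X x)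

section Collapse

variable (N : Type)

/-- The quotient map `I^N → T^N` identifying opposite faces of the cube. -/
def cubeToTorus : C(I^N, Torus N) where
  toFun t i := ((t i : ℝ) : UnitAddCircle)
  continuous_toFun := by
    refine continuous_pi fun i => ?_
    exact (AddCircle.continuous_mk' (1 : ℝ)).comp
      (continuous_subtype_val.comp (continuous_apply i))

theorem cubeToTorus_apply (t : I^N) (i : N) :
    cubeToTorus N t i = ((t i : ℝ) : UnitAddCircle) := rfl

theorem cubeToTorus_surjective : Function.Surjective (cubeToTorus N) := by
  intro z
  have h : ∀ i, ∃ s : I, ((s : ℝ) : UnitAddCircle) = z i := by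
    intro i
    have hz : z i ∈ ((↑) : ℝ → UnitAddCircle) '' Set.Icc 0 (0 + 1) := by
      rw [AddCircle.coe_image_Icc_eq]; trivial
    obtain ⟨s, hs, hsz⟩ := hz
    exact ⟨⟨s, hs.1, by simpa using hs.2⟩, hsz⟩
  choose s hs using h
  exact ⟨s, funext hs⟩

theorem isQuotientMap_cubeToTorus : Topology.IsQuotientMap (cubeToTorus N) :=
  ((cubeToTorus N).continuous.isClosedMap).isQuotientMap (cubeToTorus N).continuous
    (cubeToTorus_surjective N)

variable {N}

theorem mem_boundary_of_cubeToTorus_eq {s t : I^N} (h : cubeToTorus N s = cubeToTorus N t)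
    (hne : s ≠ t) : s ∈ Cube.boundary N := by
  obtain ⟨i, hi⟩ := Function.ne_iff.1 hne
  refine ⟨i, ?_⟩
  by_contra hb
  push Not at hb
  have hs0 : (0 : ℝ) < s i := lt_of_le_of_ne (s i).2.1 fun e => hb.1 (Subtype.ext e.symm)
  have hs1 : (s i : ℝ) < 1 := lt_of_le_of_ne (s i).2.2 fun e => hb.2 (Subtype.ext e)
  have hi' : ((s i : ℝ) : UnitAddCircle) = ((t i : ℝ) : UnitAddCircle) := congrFun h i
  apply hi
  apply Subtype.ext
  rcases eq_or_lt_of_le (t i).2.2 with ht | ht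
  · refine (AddCircle.coe_eq_coe_iff_of_mem_Ioc (p := (1 : ℝ)) (a := 0)
      ⟨hs0, by linarith⟩ ⟨by rw [ht]; norm_num, by rw [ht]; norm_num⟩).1 hi'
  · exact (AddCircle.coe_eq_coe_iff_of_mem_Ico (p := (1 : ℝ)) (a := 0)
      ⟨hs0.le, by linarith⟩ ⟨(t i).2.1, by linarith⟩).1 hi'

variable {X : Type*} [TopologicalSpace X] {x₀ : X}

theorem genLoop_const_on_fibers (f : Ω^ N X x₀) (s t : I^N)
    (h : cubeToTorus N s = cubeToTorus N t) : f.1 s = f.1 t := by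
  by_cases hne : s = t
  · rw [hne]
  · rw [f.2 s (mem_boundary_of_cubeToTorus_eq h hne),
      f.2 t (mem_boundary_of_cubeToTorus_eq h.symm (Ne.symm hne))]

/-- A map of the cube sending its boundary to `x₀`, regarded as a map on the torus.  In other
words, this is precomposition with the pinch map `T^N → T^N / (fat wedge) = I^N / ∂ I^N`. -/
def genLoopToTorusMap (f : Ω^ N X x₀) : C(Torus N, X) :=
  (isQuotientMap_cubeToTorus N).lift f.1 fun s t h => genLoop_const_on_fibers f s t h

theorem genLoopToTorusMap_apply (f : Ω^ N X x₀) (t : I^N) :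
    genLoopToTorusMap f (cubeToTorus N t) = f t :=
  ContinuousMap.congr_fun ((isQuotientMap_cubeToTorus N).lift_comp f.1
    fun s t h => genLoop_const_on_fibers f s t h) t

theorem continuous_genLoopToTorusMap :
    Continuous (genLoopToTorusMap : Ω^ N X x₀ → C(Torus N, X)) := by
  refine ContinuousMap.continuous_compactOpen.2 fun K hK U hU => ?_
  have hK' : IsCompact (cubeToTorus N ⁻¹' K) :=
    (hK.isClosed.preimage (cubeToTorus N).continuous).isCompact
  convert (ContinuousMap.isOpen_setOfPred_mapsTo (Y := X) hK' hU).preimage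
    (continuous_subtype_val : Continuous (Subtype.val : Ω^ N X x₀ → C(I^N, X))) using 1
  ext f
  constructor
  · intro hf s hs
    have := hf hs
    rwa [genLoopToTorusMap_apply] at this
  · intro hf z hz
    obtain ⟨s, rfl⟩ := cubeToTorus_surjective N z
    rw [genLoopToTorusMap_apply]
    exact hf hz

theorem genLoopToTorusMap_const :
    genLoopToTorusMap (GenLoop.const : Ω^ N X x₀) = ContinuousMap.const _ x₀ := by
  ext z
  obtain ⟨s, rfl⟩ := cubeToTorus_surjective N z
  rw [genLoopToTorusMap_apply]
  rfl

end Collapse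

section CanonicalMap

variable (m : ℕ) (X : Type*) [TopologicalSpace X] (x₀ : X)

/-- The isomorphism `π_{m+1}(X, x₀) ≅ π₁(Ω^m X, const)`, the loop coordinate being the first
coordinate of the cube. -/
def piEquivPi1GenLoop :
    π_ (m + 1) X x₀ ≃*
      FundamentalGroup (Ω^ { j : Fin (m + 1) // j ≠ 0 } X x₀) GenLoop.const where
  toEquiv := homotopyGroupEquivFundamentalGroup (0 : Fin (m + 1))
  map_mul' a b := by
    induction a using Quotient.inductionOn with | _ p =>
    induction b using Quotient.inductionOn with | _ q =>
    refine (congrArg (homotopyGroupEquivFundamentalGroup (0 : Fin (m + 1)))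
      (HomotopyGroup.mul_spec (i := 0) (p := p) (q := q))).trans ?_
    rw [← GenLoop.fromLoop_trans_toLoop]
    change (⟦GenLoop.toLoop 0 (GenLoop.fromLoop 0 _)⟧ : Path.Homotopic.Quotient _ _) = _
    rw [GenLoop.to_from]
    rfl

/-- The map `Ω^m X → X^{T^m}` (with the coordinates other than the first renumbered `0, …, m-1`,
in order). -/
def loopsToTorusMaps : C(Ω^ { j : Fin (m + 1) // j ≠ 0 } X x₀, C(Torus (Fin m), X)) where
  toFun f := genLoopToTorusMap (GenLoop.congr x₀ (finSuccAboveEquiv (0 : Fin (m + 1))).symm f)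
  continuous_toFun := continuous_genLoopToTorusMap.comp
    (GenLoop.congr x₀ (finSuccAboveEquiv (0 : Fin (m + 1))).symm).continuous

theorem loopsToTorusMaps_const :
    loopsToTorusMaps m X x₀ GenLoop.const = ContinuousMap.const _ x₀ :=
  genLoopToTorusMap_const

/-- The canonical homomorphism `π_{m+1}(X, x₀) → τ_{m+1}(X, x₀)`, that is,
`π_{m+1}(X, x₀) ≅ π₁(Ω^m X, const) → π₁(X^{T^m}, const)`, the second map being induced by
`Ω^m X → X^{T^m}`. -/
def piToTau : π_ (m + 1) X x₀ →* TorusHomotopyGroup (m + 1) X x₀ :=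
  (FundamentalGroup.mapOfEq (loopsToTorusMaps m X x₀) (loopsToTorusMaps_const m X x₀)).comp
    (piEquivPi1GenLoop m X x₀).toMonoidHom

end CanonicalMap

end Fox

end

/-! Let `Z(S, D) = torusMaps x₀ S D` be the space of maps `T^N → X` that are constantly `x₀` where a
coordinate in `S` vanishes and that do not depend on the coordinates in `D`. For a direction `i`
outside `S ∪ D`, cutting along the `i`-th coordinate identifies `Z(S, D)` with the free loops in
`Y = Z(S, D ∪ {i})`, and `Z(S ∪ {i}, D)` with the loops based at the constant map. The free loop
space of `Y` is path-connected iff `Y` and `ΩY` are. Starting from `Z(S, Sᶜ) = Ω^S X`, induction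
shows that `Z(S, D)` is path-connected iff `π_k X` vanishes for `#S ≤ k ≤ #N - #D`.

With `N = {0, …, m}`, `τ_{m+1}` is `π₀ Z({0}, ∅)` and `π_{m+1}` is `π₀ Z(N, ∅)`, the canonical map
being the inclusion. It has trivial kernel because a loop which is freely null-homotopic is
null-homotopic; making the coordinates based one at a time gives surjectivity. -/

namespace Fox

open ContinuousMap Set
open Function hiding const

section PathsOfMaps

variable {K L X : Type*} [TopologicalSpace K] [TopologicalSpace L] [TopologicalSpace X]

theorem isInducing_precomp [CompactSpace K] [T2Space L] {q : C(K, L)} (hq : Surjective q) :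
    Topology.IsInducing fun f : C(L, X) => f.comp q := by
  refine ⟨le_antisymm (continuous_precomp q).le_induced ?_⟩
  let : TopologicalSpace C(L, X) := .induced (fun f => f.comp q) inferInstance
  refine continuous_id_iff_le.1 (continuous_compactOpen.2 fun C hC U hU => ?_)
  have hC' : IsCompact (q ⁻¹' C) := (hC.isClosed.preimage q.continuous).isCompact
  refine ⟨_, isOpen_setOfPred_mapsTo hC' hU, ?_⟩
  ext f
  exact ⟨fun h => hq.forall.2 h, fun h t ht => h ht⟩

theorem homotopicWith_iff_joinedIn [LocallyCompactSpace K] {P : C(K, X) → Prop} {f g : C(K, X)} :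
    HomotopicWith f g P ↔ JoinedIn {h | P h} f g := by
  constructor
  · rintro ⟨F⟩
    exact ⟨⟨F.toHomotopy.curry, F.toHomotopy.curry_zero, F.toHomotopy.curry_one⟩, F.prop⟩
  · rintro ⟨γ, hγ⟩
    exact ⟨⟨⟨γ.toContinuousMap.uncurry, fun t => by simp, fun t => by simp⟩, hγ⟩⟩

end PathsOfMaps

section FreeLoops

variable {Y : Type*} [TopologicalSpace Y] {y z : Y}

variable (Y) in
/-- The space of free loops in `Y`, as a subspace of the space of paths. -/
def freeLoops : Set C(I, Y) := {p | p 0 = p 1}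

/-- The space of loops in `Y` based at `y`, as a subspace of the space of paths. -/
def basedLoops (y : Y) : Set C(I, Y) := {p | p 0 = y ∧ p 1 = y}

theorem basedLoops_subset_freeLoops : basedLoops y ⊆ freeLoops Y :=
  fun _ hp => hp.1.trans hp.2.symm

theorem coe_mem_basedLoops (p : Path y y) : (p : C(I, Y)) ∈ basedLoops y :=
  ⟨p.source, p.target⟩

theorem homotopic_iff_joinedIn_basedLoops {p q : Path y y} :
    p.Homotopic q ↔ JoinedIn (basedLoops y) (p : C(I, Y)) q := by
  rw [show p.Homotopic q ↔ HomotopicWith (p : C(I, Y)) q fun h => ∀ x ∈ ({0, 1} : Set I), h x = p x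
    from Iff.rfl, homotopicWith_iff_joinedIn]
  simp [basedLoops]

theorem subsingleton_fundamentalGroup_iff :
    Subsingleton (FundamentalGroup Y y) ↔ IsPathConnected (basedLoops y) := by
  refine ⟨fun _ => ⟨const I y, ⟨rfl, rfl⟩, fun {q} hq => ?_⟩, fun h => ⟨?_⟩⟩
  · let γ : Path y y := ⟨q, hq.1, hq.2⟩
    exact homotopic_iff_joinedIn_basedLoops.1 <| Path.Homotopic.Quotient.exact <|
      Subsingleton.elim (FundamentalGroup.fromPath (.mk (Path.refl y))) (.fromPath (.mk γ))
  · rintro ⟨p⟩ ⟨q⟩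
    exact Quotient.sound <| homotopic_iff_joinedIn_basedLoops.2 <|
      h.joinedIn _ (coe_mem_basedLoops p) _ (coe_mem_basedLoops q)

theorem exists_homotopic_of_joinedIn_freeLoops {p : Path y y} {q : Path z z}
    (h : JoinedIn (freeLoops Y) (p : C(I, Y)) q) :
    ∃ k : Path y z, (p.trans k).Homotopic (k.trans q) := by
  obtain ⟨F⟩ := homotopicWith_iff_joinedIn.2 h
  let k : Path y z := (F.evalAt 0).cast p.source.symm q.source.symm
  have hk : (F.evalAt 1).cast p.target.symm q.target.symm = k :=
    Path.ext <| funext fun s => (F.prop s).symm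
  refine ⟨k, ?_⟩
  convert (Path.Homotopic.map_trans_evalAt F.toHomotopy .id).pathCast p.source.symm q.target.symm
  · rw [Path.cast_trans _ _ _ p.target.symm, hk]
    rfl
  · rw [Path.cast_trans _ _ _ q.source.symm]
    rfl

theorem joinedIn_freeLoops_trans_symm (k : Path y z) (q : Path z z) :
    JoinedIn (freeLoops Y) (k.trans (q.trans k.symm) : C(I, Y)) q := by
  obtain ⟨k, rfl, rfl⟩ := k
  let k' : Path (k 0) (k 1) := ⟨k, rfl, rfl⟩
  -- At time `r`, conjugate only by the part of `k` after `r`.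
  let F (r : I) : Path (k r) (k r) := (k'.subpath r 1).trans (q.trans (k'.subpath 1 r))
  have hF : Continuous ↿F := by
    refine Path.trans_continuous_family _ ?_ _ (Path.trans_continuous_family _ ?_ _ ?_)
    · exact k'.subpath_continuous_family.comp
        (by fun_prop : Continuous fun x : I × I => (x.1, (1 : I), x.2))
    · exact q.continuous.comp continuous_snd
    · exact k'.subpath_continuous_family.comp
        (by fun_prop : Continuous fun x : I × I => ((1 : I), x.1, x.2))
  have hk : k'.subpath 0 1 = k' := k'.subpath_zero_one
  have hF₀ : F 0 = k'.trans (q.trans k'.symm) := by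
    change (k'.subpath 0 1).trans (q.trans (k'.subpath 1 0)) = _
    rw [← k'.symm_subpath 0 1, hk]
  have hF₁ : F 1 = (Path.refl (k 1)).trans (q.trans (Path.refl (k 1))) := by simp [F, k']
  have hF₁q : (F 1).Homotopic q := by
    rw [hF₁, ← Path.Homotopic.Quotient.eq]
    simp
  refine JoinedIn.trans ⟨⟨⟨fun r => (F r : C(I, Y)), ?_⟩, ?_, rfl⟩, fun r => ?_⟩
    ((homotopic_iff_joinedIn_basedLoops.1 hF₁q).mono basedLoops_subset_freeLoops)
  · exact continuous_of_continuous_uncurry _ hF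
  · exact congrArg Path.toContinuousMap hF₀
  · exact (F r).source.trans (F r).target.symm

theorem joinedIn_basedLoops_const {p : C(I, Y)} (hp : p ∈ basedLoops y)
    (h : JoinedIn (freeLoops Y) p (const I y)) : JoinedIn (basedLoops y) p (const I y) := by
  let γ : Path y y := ⟨p, hp.1, hp.2⟩
  obtain ⟨k, hk⟩ := exists_homotopic_of_joinedIn_freeLoops (p := γ) (q := Path.refl y) h
  refine (homotopic_iff_joinedIn_basedLoops (p := γ) (q := .refl y)).1 ?_
  refine Path.Homotopic.Quotient.exact ?_
  have := congrArg (·.trans (.symm (.mk k))) (Path.Homotopic.Quotient.eq.2 hk)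
  simpa using this

theorem exists_mem_basedLoops_joinedIn [PathConnectedSpace Y] (y : Y) {p : C(I, Y)}
    (hp : p ∈ freeLoops Y) : ∃ q ∈ basedLoops y, JoinedIn (freeLoops Y) p q := by
  let γ : Path (p 0) (p 0) := ⟨p, rfl, hp.symm⟩
  let k : Path y (p 0) := PathConnectedSpace.somePath y (p 0)
  exact ⟨k.trans (γ.trans k.symm), coe_mem_basedLoops _,
    (joinedIn_freeLoops_trans_symm k γ).symm⟩

end FreeLoops

section GenLoops

variable {N X : Type*} [TopologicalSpace X] {x₀ : X}

theorem genLoop_homotopic_iff_joinedIn {p q : Ω^ N X x₀} :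
    GenLoop.Homotopic p q ↔ JoinedIn (Ω^ N X x₀) (p : C(I^N, X)) q := by
  rw [show GenLoop.Homotopic p q ↔
      HomotopicWith (p : C(I^N, X)) q fun h => ∀ t ∈ Cube.boundary N, h t = p t from Iff.rfl,
    homotopicWith_iff_joinedIn]
  congr! 1
  exact Set.ext fun h => forall₂_congr fun t ht => Eq.congr_right (p.2 t ht)

theorem subsingleton_homotopyGroup_iff :
    Subsingleton (HomotopyGroup N X x₀) ↔ IsPathConnected (Ω^ N X x₀) := by
  refine ⟨fun h => ⟨_, GenLoop.const.2, fun {q} hq => ?_⟩, fun h => ⟨?_⟩⟩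
  · exact genLoop_homotopic_iff_joinedIn.1 <| Quotient.exact <|
      (h.elim ⟦GenLoop.const⟧ ⟦⟨q, hq⟩⟧ : (_ : HomotopyGroup N X x₀) = _)
  · rintro ⟨p⟩ ⟨q⟩
    exact Quotient.sound <| genLoop_homotopic_iff_joinedIn.2 <| h.joinedIn _ p.2 _ q.2

end GenLoops

section TorusMaps

variable {N X : Type*} [DecidableEq N] [TopologicalSpace X] {x₀ : X} {S D : Finset N}
  {i : N} {f : C(I^N, X)}

/-- The map `f` on the cube descends to a map on the torus whose coordinates in `D` are dummy, and
which is constantly `x₀` on the subtori where some coordinate in `S` vanishes. -/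
structure IsTorusMap (x₀ : X) (S D : Finset N) (f : C(I^N, X)) : Prop where
  periodic : ∀ t i, f (update t i 0) = f (update t i 1)
  based : ∀ t, ∀ i ∈ S, f (update t i 0) = x₀
  indep : ∀ t, ∀ i ∈ D, ∀ a, f (update t i a) = f t

/-- The space of maps satisfying `IsTorusMap x₀ S D`. It interpolates between the space of maps
of the torus (`S = D = ∅`) and the iterated loop space of `X` (`S = univ`). -/
def torusMaps (x₀ : X) (S D : Finset N) : Set C(I^N, X) := {f | IsTorusMap x₀ S D f}

theorem const_mem_torusMaps : const (I^N) x₀ ∈ torusMaps x₀ S D :=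
  ⟨fun _ _ => rfl, fun _ _ _ => rfl, fun _ _ _ _ => rfl⟩

theorem torusMaps_subset {S' D' : Finset N} (hS : S' ⊆ S) (hD : D' ⊆ D) :
    torusMaps x₀ S D ⊆ torusMaps x₀ S' D' := fun _ hf =>
  ⟨hf.periodic, fun t i hi => hf.based t i (hS hi), fun t i hi => hf.indep t i (hD hi)⟩

/-- The restriction of a map on the cube to the slice where the `i`-th coordinate is `a`, made
independent of that coordinate. -/
def slice (i : N) (a : I) (f : C(I^N, X)) : C(I^N, X) :=
  f.comp ⟨fun t => update t i a, by fun_prop⟩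

theorem slice_apply (a : I) (t : I^N) : slice i a f t = f (update t i a) := rfl

theorem continuous_slice : Continuous fun p : C(I^N, X) × I => slice i p.2 p.1 := by
  refine continuous_of_continuous_uncurry _ ?_
  simp only [uncurry_def, slice_apply]
  fun_prop

theorem slice_mem_torusMaps (hi : i ∉ S) (a : I) (hf : f ∈ torusMaps x₀ S D) :
    slice i a f ∈ torusMaps x₀ S (insert i D) where
  periodic t j := by
    obtain rfl | hj := eq_or_ne j i
    · simp [slice_apply]
    · simpa only [slice_apply, update_comm hj] using hf.periodic (update t i a) j
  based t j hj := by
    have hji : j ≠ i := ne_of_mem_of_not_mem hj hi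
    simpa only [slice_apply, update_comm hji] using hf.based (update t i a) j hj
  indep t j hj b := by
    obtain rfl | hji := eq_or_ne j i
    · simp [slice_apply]
    · simpa only [slice_apply, update_comm hji] using
        hf.indep (update t i a) j (Finset.mem_of_mem_insert_of_ne hj hji) b

/-- Slicing in a direction outside `S`, as a path of torus maps. -/
def slices (hi : i ∉ S) : C(torusMaps x₀ S D, C(I, torusMaps x₀ S (insert i D))) :=
  curry ⟨fun p => ⟨slice i p.2 p.1, slice_mem_torusMaps hi p.2 p.1.2⟩,
    (continuous_slice.comp (continuous_subtype_val.prodMap continuous_id)).subtype_mk _⟩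

/-- The map on the cube with prescribed slices in the direction `i`. -/
def glue (i : N) : C(C(I, torusMaps x₀ S (insert i D)), C(I^N, X)) :=
  curry ⟨fun p => (p.1 (p.2 i)).1 p.2, by fun_prop⟩

theorem glue_apply (p : C(I, torusMaps x₀ S (insert i D))) (t : I^N) :
    glue i p t = (p (t i)).1 t := rfl

theorem glue_slices (hi : i ∉ S) (f : torusMaps x₀ S D) : glue i (slices hi f) = f := by
  ext t
  exact congrArg f.1 (update_eq_self i t)

theorem slices_mem_freeLoops (hi : i ∉ S) (f : torusMaps x₀ S D) :
    slices hi f ∈ freeLoops (torusMaps x₀ S (insert i D)) :=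
  Subtype.ext <| ContinuousMap.ext fun t => f.2.periodic t i

theorem slices_mem_basedLoops (hi : i ∉ S) {f : torusMaps x₀ S D}
    (hf : f.1 ∈ torusMaps x₀ (insert i S) D) :
    slices hi f ∈ basedLoops ⟨const (I^N) x₀, const_mem_torusMaps⟩ := by
  have h₀ : slices hi f 0 = ⟨const (I^N) x₀, const_mem_torusMaps⟩ :=
    Subtype.ext <| ContinuousMap.ext fun t => hf.based t i (Finset.mem_insert_self i S)
  exact ⟨h₀, (slices_mem_freeLoops hi f).symm.trans h₀⟩

theorem glue_mem_torusMaps (hi : i ∉ S) (hiD : i ∉ D) {p : C(I, torusMaps x₀ S (insert i D))}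
    (hp : p ∈ freeLoops _) : glue i p ∈ torusMaps x₀ S D where
  periodic t j := by
    obtain rfl | hj := eq_or_ne j i
    · have hp : p 0 = p 1 := hp
      simp [glue_apply, hp, (p _).2.indep _ _ (Finset.mem_insert_self _ _)]
    · simpa only [glue_apply, update_of_ne hj.symm] using (p (t i)).2.periodic t j
  based t j hj := by
    have hji : j ≠ i := ne_of_mem_of_not_mem hj hi
    simpa only [glue_apply, update_of_ne hji.symm] using (p (t i)).2.based t j hj
  indep t j hj b := by
    have hji : j ≠ i := ne_of_mem_of_not_mem hj hiD
    simpa only [glue_apply, update_of_ne hji.symm] using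
      (p (t i)).2.indep t j (Finset.mem_insert_of_mem hj) b

theorem glue_mem_torusMaps_insert (hi : i ∉ S) (hiD : i ∉ D)
    {p : C(I, torusMaps x₀ S (insert i D))}
    (hp : p ∈ basedLoops ⟨const (I^N) x₀, const_mem_torusMaps⟩) :
    glue i p ∈ torusMaps x₀ (insert i S) D := by
  have hf := glue_mem_torusMaps hi hiD (basedLoops_subset_freeLoops hp)
  refine ⟨hf.periodic, fun t => Finset.forall_mem_insert _ _ _ |>.2 ⟨?_, hf.based t⟩, hf.indep⟩
  rw [glue_apply, update_self, hp.1]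
  rfl

theorem joinedIn_torusMaps_insert_const (hi : i ∉ S) (hiD : i ∉ D)
    (hf : f ∈ torusMaps x₀ (insert i S) D) (h : JoinedIn (torusMaps x₀ S D) f (const _ x₀)) :
    JoinedIn (torusMaps x₀ (insert i S) D) f (const _ x₀) := by
  have hfree : JoinedIn (freeLoops (torusMaps x₀ S (insert i D)))
      (slices hi ⟨f, h.source_mem⟩) (slices hi ⟨_, h.target_mem⟩) :=
    ((joinedIn_univ.2 h.joined_subtype).map (slices hi).continuous).mono <| by
      rintro _ ⟨g, -, rfl⟩
      exact slices_mem_freeLoops hi g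
  have hbased := (joinedIn_basedLoops_const (slices_mem_basedLoops hi hf) hfree).map
    (glue i).continuous
  rw [glue_slices] at hbased
  exact hbased.mono <| image_subset_iff.2 fun p hp => glue_mem_torusMaps_insert hi hiD hp

theorem exists_mem_torusMaps_insert_joinedIn (hi : i ∉ S) (hiD : i ∉ D)
    (h : IsPathConnected (torusMaps x₀ S (insert i D))) (hf : f ∈ torusMaps x₀ S D) :
    ∃ g ∈ torusMaps x₀ (insert i S) D, JoinedIn (torusMaps x₀ S D) f g := by
  have := isPathConnected_iff_pathConnectedSpace.1 h
  obtain ⟨q, hq, hfq⟩ := exists_mem_basedLoops_joinedIn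
    (⟨const _ x₀, const_mem_torusMaps⟩ : torusMaps x₀ S (insert i D))
    (slices_mem_freeLoops hi ⟨f, hf⟩)
  refine ⟨glue i q, glue_mem_torusMaps_insert hi hiD hq, ?_⟩
  have := hfq.map (glue i).continuous
  rw [glue_slices] at this
  exact this.mono <| image_subset_iff.2 fun p hp => glue_mem_torusMaps hi hiD hp

theorem slice_eq_self (hi : i ∈ D) (a : I) (hf : f ∈ torusMaps x₀ S D) : slice i a f = f :=
  ContinuousMap.ext fun t => hf.indep t i hi a

theorem slice_eq_const (hi : i ∈ S) (hf : f ∈ torusMaps x₀ S D) : slice i 0 f = const _ x₀ :=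
  ContinuousMap.ext fun t => hf.based t i hi

theorem joinedIn_torusMaps_slice {g : C(I^N, X)} (hi : i ∉ S) (a : I)
    (h : JoinedIn (torusMaps x₀ S D) f g) :
    JoinedIn (torusMaps x₀ S (insert i D)) (slice i a f) (slice i a g) :=
  (h.map (continuous_slice.comp (Continuous.prodMk_left a))).mono <|
    image_subset_iff.2 fun _ => slice_mem_torusMaps hi a

theorem isPathConnected_torusMaps_iff_insert (hi : i ∉ S) (hiD : i ∉ D) :
    IsPathConnected (torusMaps x₀ S D) ↔
      IsPathConnected (torusMaps x₀ S (insert i D)) ∧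
        IsPathConnected (torusMaps x₀ (insert i S) D) := by
  have hleft : torusMaps x₀ (insert i S) D ⊆ torusMaps x₀ S D :=
    torusMaps_subset (Finset.subset_insert i S) subset_rfl
  have hright : torusMaps x₀ S (insert i D) ⊆ torusMaps x₀ S D :=
    torusMaps_subset subset_rfl (Finset.subset_insert i D)
  refine ⟨fun h => ⟨?_, ?_⟩, fun ⟨hD, hS⟩ => ?_⟩
  · refine ⟨_, const_mem_torusMaps, fun f hf => ?_⟩
    rw [← slice_eq_self (Finset.mem_insert_self i D) 0 hf]
    exact joinedIn_torusMaps_slice hi 0 (h.joinedIn _ const_mem_torusMaps _ (hright hf))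
  · exact ⟨_, const_mem_torusMaps, fun _ hf => (joinedIn_torusMaps_insert_const hi hiD hf
      (h.joinedIn _ (hleft hf) _ const_mem_torusMaps)).symm⟩
  · refine ⟨_, const_mem_torusMaps, fun f hf => ?_⟩
    obtain ⟨g, hg, hfg⟩ := exists_mem_torusMaps_insert_joinedIn hi hiD hD hf
    exact ((hS.joinedIn _ const_mem_torusMaps _ hg).mono hleft).trans hfg.symm

theorem eq_or_endpoints_of_coe_eq {a b : I}
    (h : ((a : ℝ) : UnitAddCircle) = ((b : ℝ) : UnitAddCircle)) :
    a = b ∨ (a = 0 ∨ a = 1) ∧ (b = 0 ∨ b = 1) := by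
  have endpoint {c d : I} (hcd : ((c : ℝ) : UnitAddCircle) = ((d : ℝ) : UnitAddCircle))
      (hne : c ≠ d) : c = 0 ∨ c = 1 := by
    obtain ⟨_, hc⟩ := mem_boundary_of_cubeToTorus_eq (N := Unit) (s := fun _ => c)
      (t := fun _ => d) (funext fun _ => hcd) fun e => hne (congrFun e ())
    exact hc
  exact or_iff_not_imp_left.2 fun hab => ⟨endpoint h hab, endpoint h.symm (Ne.symm hab)⟩

theorem IsTorusMap.apply_eq_base (hf : IsTorusMap x₀ S D f) (hi : i ∈ S) {t : I^N}
    (ht : t i = 0 ∨ t i = 1) : f t = x₀ := by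
  rw [← update_eq_self i t]
  obtain ht | ht := ht <;> rw [ht]
  · exact hf.based t i hi
  · exact (hf.periodic t i).symm.trans (hf.based t i hi)

theorem IsTorusMap.apply_eq [Finite N] (hf : IsTorusMap x₀ S D f) {t t' : I^N}
    (h : ∀ i ∉ D, ((t i : ℝ) : UnitAddCircle) = ((t' i : ℝ) : UnitAddCircle)) : f t = f t' := by
  have hupdate (u : I^N) (i : N) : f (update u i (t' i)) = f (update u i (t i)) := by
    by_cases hi : i ∈ D
    · rw [hf.indep u i hi, hf.indep u i hi]
    obtain h | ⟨h | h, h' | h'⟩ := eq_or_endpoints_of_coe_eq (h i hi)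
    · rw [h]
    all_goals rw [h, h']
    exacts [(hf.periodic u i).symm, hf.periodic u i]
  have hpiecewise (E : Finset N) : f (E.piecewise t' t) = f t := by
    induction E using Finset.induction_on with
    | empty => rw [Finset.piecewise_empty]
    | insert i E hi ih =>
      rw [Finset.piecewise_insert, hupdate, ← E.piecewise_eq_of_notMem t' t hi, update_eq_self, ih]
  have := Fintype.ofFinite N
  simpa using (hpiecewise Finset.univ).symm

theorem torusMaps_univ_empty [Fintype N] : torusMaps x₀ Finset.univ ∅ = Ω^ N X x₀ := by
  refine Subset.antisymm ?_ fun f hf => ⟨fun t i => ?_, fun t i _ => ?_, by simp⟩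
  · rintro f hf t ⟨i, ht⟩
    exact hf.apply_eq_base (Finset.mem_univ i) ht
  · rw [hf _ ⟨i, by simp⟩, hf _ ⟨i, by simp⟩]
  · exact hf _ ⟨i, by simp⟩

theorem image_comp_genLoop_eq_torusMaps [Fintype N] {M : Type*} (e : M ≃ S) :
    (fun f : C(I^M, X) => f.comp ⟨fun (t : I^N) j => t (e j), by fun_prop⟩) '' (Ω^ M X x₀) =
      torusMaps x₀ S Sᶜ := by
  apply Subset.antisymm
  · rintro _ ⟨f, hf, rfl⟩
    have hface (t : I^N) {i : N} (hi : i ∈ S) {a : I} (ha : a = 0 ∨ a = 1) :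
        f (fun j => update t i a (e j)) = x₀ :=
      hf _ ⟨e.symm ⟨i, hi⟩, by simpa using ha⟩
    have hupdate (t : I^N) {i : N} (hi : i ∉ S) (a : I) :
        (fun j => update t i a (e j)) = fun j => t (e j) :=
      funext fun j => update_of_ne (ne_of_mem_of_not_mem (e j).2 hi) _ _
    refine ⟨fun t i => ?_, fun t i hi => hface t hi (.inl rfl), fun t i hi a => ?_⟩
    · by_cases hi : i ∈ S
      · exact (hface t hi (.inl rfl)).trans (hface t hi (.inr rfl)).symm
      · exact congrArg f ((hupdate t hi 0).trans (hupdate t hi 1).symm)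
    · exact congrArg f (hupdate t (Finset.mem_compl.1 hi) a)
  · intro f hf
    let extend : C(I^M, I^N) := ⟨fun s i => if h : i ∈ S then s (e.symm ⟨i, h⟩) else 0,
      continuous_pi fun i => by split_ifs <;> fun_prop⟩
    refine ⟨f.comp extend, ?_, ContinuousMap.ext fun t => hf.apply_eq fun i hi => ?_⟩
    · rintro s ⟨j, hs⟩
      exact hf.apply_eq_base (e j).2 (by simpa [extend] using hs)
    · have hi : i ∈ S := by simpa using hi
      simp [extend, hi]

theorem isPathConnected_torusMaps_compl_iff [Fintype N] {M : Type*} (e : M ≃ S) :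
    IsPathConnected (torusMaps x₀ S Sᶜ) ↔ Subsingleton (HomotopyGroup M X x₀) := by
  rw [subsingleton_homotopyGroup_iff, ← image_comp_genLoop_eq_torusMaps e]
  exact (isInducing_precomp
    (Subtype.val_injective.comp e.injective).surjective_comp_right).isPathConnected_iff.symm

theorem exists_notMem_of_disjoint [Fintype N] (h : Disjoint S D) (hne : D ≠ Sᶜ) :
    ∃ i, i ∉ S ∧ i ∉ D := by
  by_contra! hSD
  exact hne (eq_compl_comm.1 (eq_compl_iff_isCompl.2 ⟨h, codisjoint_iff.2 <| by
    ext i; simpa using or_iff_not_imp_left.2 (hSD i)⟩))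

theorem isPathConnected_torusMaps_iff [Fintype N] {S D : Finset N} (h : Disjoint S D) :
    IsPathConnected (torusMaps x₀ S D) ↔
      ∀ k, S.card ≤ k → k + D.card ≤ Fintype.card N → Subsingleton (π_ k X x₀) := by
  by_cases hD : D = Sᶜ
  · have hcard : S.card + D.card = Fintype.card N := hD ▸ S.card_add_card_compl
    rw [hD, isPathConnected_torusMaps_compl_iff S.equivFin.symm, ← hD]
    refine ⟨fun hS k hk hk' => ?_, fun hk => hk _ le_rfl hcard.le⟩
    obtain rfl : k = S.card := by omega
    exact hS
  · obtain ⟨i, hi, hiD⟩ := exists_notMem_of_disjoint h hD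
    have hiSD : Disjoint S (insert i D) := Finset.disjoint_insert_right.2 ⟨hi, h⟩
    have hiS : Disjoint (insert i S) D := Finset.disjoint_insert_left.2 ⟨hiD, h⟩
    have hcard : S.card + (D.card + 1) ≤ Fintype.card N := by
      rw [← Finset.card_insert_of_notMem hiD, ← Finset.card_union_of_disjoint hiSD]
      exact Finset.card_le_univ _
    rw [isPathConnected_torusMaps_iff_insert hi hiD, isPathConnected_torusMaps_iff hiSD,
      isPathConnected_torusMaps_iff hiS, Finset.card_insert_of_notMem hi,
      Finset.card_insert_of_notMem hiD]
    -- The two smaller cases cover `#S ≤ k < #N - #D` and `#S < k ≤ #N - #D`.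
    refine ⟨fun ⟨hk, hk'⟩ k hSk hkD => ?_, fun hk => ⟨fun k _ _ => hk k ?_ ?_,
      fun k _ _ => hk k ?_ ?_⟩⟩
    · by_cases hkS : S.card + 1 ≤ k
      · exact hk' k hkS hkD
      · exact hk k hSk (by omega)
    all_goals omega
termination_by Fintype.card N - S.card - D.card
decreasing_by all_goals (rw [Finset.card_insert_of_notMem (by assumption)]; omega)

theorem joinedIn_torusMaps_univ_const [Fintype N] (hf : f ∈ torusMaps x₀ Finset.univ ∅)
    (h : JoinedIn (torusMaps x₀ S ∅) f (const _ x₀)) :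
    JoinedIn (torusMaps x₀ Finset.univ ∅) f (const _ x₀) := by
  have hunion (E : Finset N) : JoinedIn (torusMaps x₀ (E ∪ S) ∅) f (const _ x₀) := by
    induction E using Finset.induction_on with
    | empty => simpa using h
    | insert i E _ ih =>
      rw [Finset.insert_union]
      by_cases hiS : i ∈ E ∪ S
      · rwa [Finset.insert_eq_of_mem hiS]
      · exact joinedIn_torusMaps_insert_const hiS (Finset.notMem_empty i)
          (torusMaps_subset (Finset.subset_univ _) subset_rfl hf) ih
  exact Finset.union_eq_left.2 (Finset.subset_univ S) ▸ hunion Finset.univ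

theorem exists_mem_torusMaps_univ_joinedIn [Fintype N] {S : Finset N} {f : C(I^N, X)}
    (h : ∀ k, S.card ≤ k → k < Fintype.card N → Subsingleton (π_ k X x₀))
    (hf : f ∈ torusMaps x₀ S ∅) :
    ∃ g ∈ torusMaps x₀ Finset.univ ∅, JoinedIn (torusMaps x₀ S ∅) f g := by
  by_cases hS : S = Finset.univ
  · exact ⟨f, hS ▸ hf, .refl hf⟩
  obtain ⟨i, hi⟩ : ∃ i, i ∉ S := by simpa [Finset.eq_univ_iff_forall] using hS
  have hcard : (insert i S).card = S.card + 1 := Finset.card_insert_of_notMem hi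
  have hconn : IsPathConnected (torusMaps x₀ S (insert i ∅)) :=
    (isPathConnected_torusMaps_iff (by simpa using hi)).2 fun k hk hk' =>
      h k hk (by simpa using hk')
  obtain ⟨f', hf', hff'⟩ :=
    exists_mem_torusMaps_insert_joinedIn hi (Finset.notMem_empty i) hconn hf
  obtain ⟨g, hg, hfg⟩ :=
    exists_mem_torusMaps_univ_joinedIn (S := insert i S) (fun k hk => h k (by omega)) hf'
  exact ⟨g, hg, hff'.trans (hfg.mono (torusMaps_subset (Finset.subset_insert i S) subset_rfl))⟩
termination_by Fintype.card N - S.card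
decreasing_by have := Finset.card_le_univ (insert i S); omega

theorem forall_exists_mem_torusMaps_univ_joinedIn_iff [Fintype N] :
    (∀ f ∈ torusMaps x₀ S ∅,
        ∃ g ∈ torusMaps x₀ Finset.univ ∅, JoinedIn (torusMaps x₀ S ∅) f g) ↔
      ∀ k, S.card ≤ k → k < Fintype.card N → Subsingleton (π_ k X x₀) := by
  refine ⟨fun h k hSk hk => ?_, fun h _ => exists_mem_torusMaps_univ_joinedIn h⟩
  obtain ⟨i, hi⟩ : ∃ i, i ∉ S := by
    by_contra! hS
    rw [Finset.eq_univ_iff_forall.2 hS, Finset.card_univ] at hSk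
    omega
  refine (isPathConnected_torusMaps_iff (S := S) (D := {i}) (by simpa using hi)).1
    ⟨_, const_mem_torusMaps, fun f hf => ?_⟩ k hSk (by simpa using hk)
  obtain ⟨g, hg, hfg⟩ := h f (torusMaps_subset subset_rfl (Finset.empty_subset _) hf)
  -- Slicing retracts onto the maps independent of `i`: it fixes `f`, and `g` becomes constant.
  have hslice := joinedIn_torusMaps_slice hi 0 hfg
  rw [slice_eq_self (Finset.mem_singleton_self i) 0 hf,
    slice_eq_const (Finset.mem_univ i) hg] at hslice
  exact hslice.symm

end TorusMaps

section Unfold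

variable {m : ℕ} {X : Type*} [TopologicalSpace X] {x₀ : X}

/-- The quotient map `I^(m+1) → I × T^m`, the first coordinate being kept as the loop parameter. -/
def cubeToTube (m : ℕ) : C(I^(Fin (m + 1)), I × Torus (Fin m)) :=
  ⟨fun t => (t 0, cubeToTorus (Fin m) (Fin.tail t)), by unfold Fin.tail; fun_prop⟩

theorem cubeToTube_surjective (m : ℕ) : Surjective (cubeToTube m) := by
  rintro ⟨r, z⟩
  obtain ⟨u, rfl⟩ := cubeToTorus_surjective _ z
  exact ⟨Fin.cons r u, rfl⟩

theorem isQuotientMap_cubeToTube (m : ℕ) : Topology.IsQuotientMap (cubeToTube m) :=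
  (cubeToTube m).continuous.isClosedMap.isQuotientMap (cubeToTube m).continuous
    (cubeToTube_surjective m)

theorem cubeToTorus_update_zero {N : Type} [DecidableEq N] (u : I^N) (j : N) :
    cubeToTorus N (update u j 0) = cubeToTorus N (update u j 1) := by
  funext i
  obtain rfl | hi := eq_or_ne i j
  · rw [cubeToTorus_apply, cubeToTorus_apply, update_self, update_self]
    exact (AddCircle.coe_period (1 : ℝ)).symm
  · simp [cubeToTorus_apply, hi]

/-- A path of maps on the torus `T^m`, viewed as a map on the cube `I^(m+1)`. -/
def unfoldPath (p : C(I, C(Torus (Fin m), X))) : C(I^(Fin (m + 1)), X) :=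
  p.uncurry.comp (cubeToTube m)

theorem unfoldPath_apply (p : C(I, C(Torus (Fin m), X))) (t : I^(Fin (m + 1))) :
    unfoldPath p t = p (t 0) (cubeToTorus (Fin m) (Fin.tail t)) := rfl

theorem isInducing_unfoldPath :
    Topology.IsInducing (unfoldPath : C(I, C(Torus (Fin m), X)) → C(I^(Fin (m + 1)), X)) :=
  (isInducing_precomp (cubeToTube_surjective m)).comp Homeomorph.curry.symm.isInducing

theorem unfoldPath_mem_torusMaps {p : C(I, C(Torus (Fin m), X))}
    (hp : p ∈ basedLoops (const _ x₀)) : unfoldPath p ∈ torusMaps x₀ {0} ∅ where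
  periodic t i := by
    cases i using Fin.cases with
    | zero => simp [unfoldPath_apply, hp.1, hp.2]
    | succ j =>
      simp only [unfoldPath_apply, Fin.tail_update_succ, update_of_ne (Fin.succ_ne_zero j).symm,
        cubeToTorus_update_zero]
  based t i hi := by
    obtain rfl := Finset.mem_singleton.1 hi
    simp [unfoldPath_apply, hp.1]
  indep := by simp

theorem exists_unfoldPath_eq {f : C(I^(Fin (m + 1)), X)} (hf : f ∈ torusMaps x₀ {0} ∅) :
    ∃ p ∈ basedLoops (const (Torus (Fin m)) x₀), unfoldPath p = f := by
  let g : C(I × Torus (Fin m), X) := (isQuotientMap_cubeToTube m).lift f fun s t h =>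
    hf.apply_eq fun i _ => i.cases (congrArg (fun x => ((x.1 : ℝ) : UnitAddCircle)) h)
      (congrFun (congrArg Prod.snd h))
  have hg : g.comp (cubeToTube m) = f := (isQuotientMap_cubeToTube m).lift_comp _ _
  have hend {r : I} (hr : r = 0 ∨ r = 1) : g.curry r = const _ x₀ := by
    ext z
    obtain ⟨u, rfl⟩ := cubeToTorus_surjective _ z
    exact (ContinuousMap.congr_fun hg (Fin.cons r u)).trans
      (hf.apply_eq_base (Finset.mem_singleton_self 0) hr)
  exact ⟨g.curry, ⟨hend (.inl rfl), hend (.inr rfl)⟩, hg⟩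

theorem image_unfoldPath_basedLoops :
    unfoldPath '' basedLoops (const (Torus (Fin m)) x₀) = torusMaps x₀ {0} ∅ :=
  Subset.antisymm (image_subset_iff.2 fun _ => unfoldPath_mem_torusMaps)
    fun _ => exists_unfoldPath_eq

theorem homotopic_iff_joinedIn_unfoldPath {p q : Path (const (Torus (Fin m)) x₀) (const _ x₀)} :
    p.Homotopic q ↔
      JoinedIn (torusMaps x₀ {0} ∅) (unfoldPath (m := m) p) (unfoldPath (m := m) q) := by
  rw [homotopic_iff_joinedIn_basedLoops, ← image_unfoldPath_basedLoops,
    isInducing_unfoldPath.joinedIn_image (coe_mem_basedLoops p) (coe_mem_basedLoops q)]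

theorem subsingleton_torusHomotopyGroup_iff :
    Subsingleton (TorusHomotopyGroup (m + 1) X x₀) ↔
      ∀ k, 1 ≤ k → k ≤ m + 1 → Subsingleton (π_ k X x₀) := by
  rw [TorusHomotopyGroup, subsingleton_fundamentalGroup_iff,
    isInducing_unfoldPath.isPathConnected_iff, image_unfoldPath_basedLoops,
    isPathConnected_torusMaps_iff (Finset.disjoint_empty_right _)]
  simp

theorem forall_subsingleton_torusHomotopyGroup_iff (n : ℕ) (x₀ : X) :
    (∀ k, 1 ≤ k → k ≤ n → Subsingleton (TorusHomotopyGroup k X x₀)) ↔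
      ∀ k, 1 ≤ k → k ≤ n → Subsingleton (π_ k X x₀) := by
  constructor <;> rintro h (_ | k) hk hkn
  · omega
  · exact subsingleton_torusHomotopyGroup_iff.1 (h _ hk hkn) _ hk le_rfl
  · omega
  · exact subsingleton_torusHomotopyGroup_iff.2 fun l hl hlk => h l hl (hlk.trans hkn)

end Unfold

section PiToTau

variable (m : ℕ) {X : Type*} [TopologicalSpace X] (x₀ : X)

theorem piToTau_mk (p : Ω^ (Fin (m + 1)) X x₀) :
    ∃ γ : Path (const (Torus (Fin m)) x₀) (const _ x₀),
      piToTau m X x₀ ⟦p⟧ = FundamentalGroup.fromPath (.mk γ) ∧ unfoldPath γ = p.1 := by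
  refine ⟨((GenLoop.toLoop 0 p).map (loopsToTorusMaps m X x₀).continuous).cast
    (loopsToTorusMaps_const m X x₀).symm (loopsToTorusMaps_const m X x₀).symm, ?_, ?_⟩
  · exact FundamentalGroup.mapOfEq_apply (loopsToTorusMaps m X x₀) (loopsToTorusMaps_const m X x₀)
      (piEquivPi1GenLoop m X x₀ ⟦p⟧)
  · ext t
    refine (genLoopToTorusMap_apply (GenLoop.congr x₀ (finSuccAboveEquiv (0 : Fin (m + 1))).symm
      (GenLoop.toLoop 0 p (t 0))) (Fin.tail t)).trans (congrArg p (funext fun i => ?_))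
    cases i using Fin.cases with
    | zero => simp
    | succ j =>
      have : (finSuccAboveEquiv (0 : Fin (m + 1))).symm ⟨j.succ, Fin.succ_ne_zero j⟩ = j :=
        (Equiv.symm_apply_eq _).2 (Subtype.ext rfl)
      simp [this, Fin.tail]

theorem piToTau_injective : Injective (piToTau m X x₀) := by
  refine (injective_iff_map_eq_one _).2 fun a ha => ?_
  obtain ⟨p, rfl⟩ := Quotient.exists_rep a
  obtain ⟨γ, hγ, hp⟩ := piToTau_mk m x₀ p
  have hγ₁ : γ.Homotopic (.refl _) := Path.Homotopic.Quotient.exact (hγ.symm.trans ha)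
  rw [homotopic_iff_joinedIn_unfoldPath, hp] at hγ₁
  have hp₁ := joinedIn_torusMaps_univ_const (torusMaps_univ_empty.ge p.2) hγ₁
  rw [torusMaps_univ_empty] at hp₁
  exact Quotient.sound (genLoop_homotopic_iff_joinedIn.2 hp₁)

theorem piToTau_surjective_iff :
    Surjective (piToTau m X x₀) ↔ ∀ k, 1 ≤ k → k ≤ m → Subsingleton (π_ k X x₀) := by
  trans ∀ f ∈ torusMaps (N := Fin (m + 1)) x₀ {0} ∅,
    ∃ g ∈ torusMaps x₀ Finset.univ ∅, JoinedIn (torusMaps x₀ {0} ∅) f g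
  · refine ⟨fun h f hf => ?_, fun h a => ?_⟩
    · obtain ⟨q, hq, rfl⟩ := exists_unfoldPath_eq hf
      let γ : Path (const (Torus (Fin m)) x₀) (const _ x₀) := ⟨q, hq.1, hq.2⟩
      obtain ⟨⟨p⟩, hpγ⟩ := h (FundamentalGroup.fromPath (.mk γ))
      obtain ⟨γ', hγ', hp⟩ := piToTau_mk m x₀ p
      have hγγ' : γ.Homotopic γ' := Path.Homotopic.Quotient.exact (hpγ.symm.trans hγ')
      exact ⟨p, torusMaps_univ_empty.ge p.2, hp ▸ homotopic_iff_joinedIn_unfoldPath.1 hγγ'⟩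
    · obtain ⟨γ, rfl⟩ := Path.Homotopic.Quotient.mk_surjective a
      obtain ⟨g, hg, hγg⟩ := h _ (unfoldPath_mem_torusMaps (coe_mem_basedLoops γ))
      obtain ⟨γ', hγ', hp⟩ := piToTau_mk m x₀ ⟨g, torusMaps_univ_empty.le hg⟩
      refine ⟨_, hγ'.trans (Path.Homotopic.Quotient.eq.2 ?_)⟩
      rw [homotopic_iff_joinedIn_unfoldPath, hp]
      exact hγg.symm
  · simp [forall_exists_mem_torusMaps_univ_joinedIn_iff]

theorem piToTau_bijective_iff :
    Bijective (piToTau m X x₀) ↔ ∀ k, 1 ≤ k → k ≤ m → Subsingleton (π_ k X x₀) :=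
  (and_iff_right (piToTau_injective m x₀)).trans (piToTau_surjective_iff m x₀)

end PiToTau

section Basepoint

variable {m : ℕ} {X : Type*} [TopologicalSpace X]

theorem forall_subsingleton_pi_of_joined {x y : X} (hxy : Joined x y)
    (h : ∀ k, 1 ≤ k → k ≤ m → Subsingleton (π_ k X x)) :
    ∀ k, 1 ≤ k → k ≤ m → Subsingleton (π_ k X y) := by
  cases m with
  | zero => exact fun k hk hk₀ => absurd hk (by omega)
  | succ m =>
    rw [← subsingleton_torusHomotopyGroup_iff] at h ⊢
    obtain ⟨γ⟩ := hxy
    have e := FundamentalGroup.fundamentalGroupMulEquivOfPath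
      (γ.map (continuous_const' : Continuous (const (Torus (Fin m)))))
    exact e.toEquiv.subsingleton_congr.1 h

theorem isNConnected_iff [PathConnectedSpace X] (x : X) :
    IsNConnected m X ↔ ∀ k, 1 ≤ k → k ≤ m → Subsingleton (π_ k X x) :=
  ⟨fun h => h.2 x, fun h => ⟨inferInstance, fun _ =>
    forall_subsingleton_pi_of_joined (PathConnectedSpace.joined x _) h⟩⟩

end Basepoint

end Fox

theorem proposition1 {X : Type*} [TopologicalSpace X] (x₀ : X) :
    (∀ n : ℕ,
      (∀ k : ℕ, 1 ≤ k → k ≤ n → Subsingleton (Fox.TorusHomotopyGroup k X x₀)) ↔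
        (∀ k : ℕ, 1 ≤ k → k ≤ n → Subsingleton (HomotopyGroup.Pi k X x₀))) ∧
    (∀ m : ℕ,
      (Function.Bijective (Fox.piToTau m X x₀) ↔
        ∀ k : ℕ, 1 ≤ k → k ≤ m → Subsingleton (HomotopyGroup.Pi k X x₀)) ∧
      (PathConnectedSpace X →
        (Function.Bijective (Fox.piToTau m X x₀) ↔ Fox.IsNConnected m X))) :=
  ⟨fun n => Fox.forall_subsingleton_torusHomotopyGroup_iff n x₀, fun m =>
    ⟨Fox.piToTau_bijective_iff m x₀, fun _ =>
      (Fox.piToTau_bijective_iff m x₀).trans (Fox.isNConnected_iff x₀).symm⟩⟩
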